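/- For a finite set of data points $X=\{x_1,\dots,x_N\}\subset\mathbb{R}^D$, the (unweighted) fuzzy $2$-means problem with fuzzifier $m=2$ asks for mean vectors $\mu_1,\mu_2\in\mathbb{R}^D$ and membership values $r_{nk}\in[0,1]$ with $r_{n1}+r_{n2}=1$ for all $n$ that minimize $$\sum_{n=1}^N\sum_{k=1}^2 r_{nk}^2\,\|x_n-\mu_k\|^2 .$$ In general, this problem cannot be solved optimally by radicals over $\mathbb{Q}$, for integer inputs with at least $6$ points in any dimension $D\ge 1$. More precisely: 1. For $D=1$ and $X=\{-3,-2,-1,1,2,3\}$ an optimal solution exists, and in every optimal solution neither of the two means and none of the twelve membership values can be expressed by rational numbers, the operations $+,-,\cdot,/$ and the extraction of $q$-th roots, $q\geq 1$ (with complex intermediate results allowed). 2. For every $D\geq 1$ there is a set $X\subset\mathbb{N}^D$ of exactly $6$ distinct points such that an optimal solution exists, and in every optimal solution no coordinate of a mean vector and no membership value can be expressed in this way. -/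

import Mathlib

namespace FuzzyKMeans

variable {ι : Type*} [Fintype ι] {D K : ℕ}

/-- Admissible membership values: `R n k ∈ [0, 1]`, and the memberships of every data point
sum up to one. -/
def IsMembership (R : ι → Fin K → ℝ) : Prop :=
  (∀ n k, R n k ∈ Set.Icc (0 : ℝ) 1) ∧ ∀ n, ∑ k, R n k = 1

/-- The fuzzy `K`-means cost, with fuzzifier `m`, of the mean vectors `C` and the memberships `R`
on the data points `x n` with weights `w n`. -/
noncomputable def cost (m : ℕ) (x : ι → EuclideanSpace ℝ (Fin D)) (w : ι → ℝ)
    (C : Fin K → EuclideanSpace ℝ (Fin D)) (R : ι → Fin K → ℝ) : ℝ :=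
  ∑ n, ∑ k, R n k ^ m * w n * ‖x n - C k‖ ^ 2

/-- `(C, R)` is an optimal solution of the fuzzy `K`-means problem: a global minimizer of the cost
among all mean vectors and all admissible memberships. -/
def IsOptimal (m : ℕ) (x : ι → EuclideanSpace ℝ (Fin D)) (w : ι → ℝ)
    (C : Fin K → EuclideanSpace ℝ (Fin D)) (R : ι → Fin K → ℝ) : Prop :=
  IsMembership R ∧
    ∀ (C' : Fin K → EuclideanSpace ℝ (Fin D)) (R' : ι → Fin K → ℝ),
      IsMembership R' → cost m x w C R ≤ cost m x w C' R'

/-- A real number is expressible by radicals over `ℚ` if it can be obtained from rational numbers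
by `+`, `-`, `*`, `/` and extraction of `q`-th roots, where all intermediate results may be
complex and every branch of a root may be taken. -/
def ExpressibleByRadicals (a : ℝ) : Prop :=
  (a : ℂ) ∈ solvableByRad ℚ ℂ

/-- A solution `(C, R)` is not solvable by radicals: no coordinate of a mean vector and no
membership value is expressible by radicals over `ℚ`. -/
def NotSolvableByRadicals (C : Fin K → EuclideanSpace ℝ (Fin D)) (R : ι → Fin K → ℝ) : Prop :=
  (∀ k d, ¬ ExpressibleByRadicals (C k d)) ∧ ∀ n k, ¬ ExpressibleByRadicals (R n k)

/-- The unweighted fuzzy `K`-means instance `x` has an optimal solution, and none of its optimal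
solutions is solvable by radicals. -/
def NotOptimallySolvableByRadicals (m K : ℕ) (x : ι → EuclideanSpace ℝ (Fin D)) : Prop :=
  (∃ (C : Fin K → EuclideanSpace ℝ (Fin D)) (R : ι → Fin K → ℝ),
      IsOptimal m x (fun _ => 1) C R) ∧
    ∀ (C : Fin K → EuclideanSpace ℝ (Fin D)) (R : ι → Fin K → ℝ),
      IsOptimal m x (fun _ => 1) C R → NotSolvableByRadicals C R

/-- The points of a finite set `X ⊆ ℤ^D`, viewed as data points in `ℝ^D`. -/
def points (X : Finset (Fin D → ℤ)) : X → EuclideanSpace ℝ (Fin D) :=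
  fun p => WithLp.toLp 2 (fun d => ((p.1 d : ℤ) : ℝ))

end FuzzyKMeans

/-! For means c + h and c - h with h ≠ 0 the best memberships are explicit, and twice the least cost
of a point x is ((x - c)^2 - h^2)^2 / ((x - c)^2 + h^2). Adding the terms of x and -x gives a
function of q = c^2 and t = h^2 alone. For the points ±1, ±2, ±3 the minimum lies on q = 0: if t ≤
9, linear bounds in q for the three pairs add up to a positive slope, and if t ≥ 9, the cost is too
large. On q = 0 the cost is convex in t, and its critical point t₀ is a root of an integer sextic.
Hence the optimal means are ±√t₀ and the memberships are determined
(`totalCost_critical_le_lineCost`).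

The monic sextic satisfied by 3 * t₀ is irreducible, and modulo 17 it is a linear factor times an
irreducible quintic. Its Galois group is therefore transitive on six roots and has order divisible
by 5, and no such group is solvable (`not_isSolvable_of_five_dvd_card`). So t₀ is not expressible by
radicals. Neither is a mean, whose square is t₀, nor a membership, over which √t₀ satisfies a
quadratic equation.

In dimension D the points are placed on the diagonal. The cost is then a sum over coordinates of
one-dimensional costs with common memberships, and a single choice of memberships is optimal for all
coordinates at once. -/

open MulAction Polynomial FuzzyKMeans

/-! ### Transitive permutation groups of degree six -/

/-- In a finite group with an element of order five acting faithfully and transitively on six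
points, every nontrivial normal subgroup is transitive. -/
theorem isPretransitive_of_normal_of_five_dvd_card {G Ω : Type*} [Group G] [Finite G]
    [MulAction G Ω] [FaithfulSMul G Ω] [IsPretransitive G Ω] (hΩ : Nat.card Ω = 6)
    (h5 : 5 ∣ Nat.card G) (N : Subgroup G) [hN : N.Normal] (hN1 : N ≠ ⊥) :
    IsPretransitive N Ω := by
  have : Finite Ω := Nat.finite_of_card_ne_zero (by omega)
  have : Fact (Nat.Prime 5) := ⟨by norm_num⟩
  obtain ⟨σ, hσ⟩ := exists_prime_orderOf_dvd_card' 5 h5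
  have hp : IsPGroup 5 (Subgroup.zpowers σ) :=
    IsPGroup.of_card (n := 1) (by rw [Nat.card_zpowers, hσ, pow_one])
  have hmod := hp.card_modEq_card_fixedPoints Ω
  rw [hΩ] at hmod
  have hle : Nat.card (fixedPoints (Subgroup.zpowers σ) Ω) ≤ 6 :=
    hΩ ▸ Nat.card_le_card_of_injective _ Subtype.val_injective
  have hne : Nat.card (fixedPoints (Subgroup.zpowers σ) Ω) ≠ 6 := by
    intro h
    have huniv : fixedPoints (Subgroup.zpowers σ) Ω = Set.univ := by
      apply Set.eq_of_subset_of_ncard_le (Set.subset_univ _)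
      rw [Set.ncard_univ, hΩ, ← h, Nat.card_coe_set_eq]
    have h1 : σ = 1 := by
      apply FaithfulSMul.eq_of_smul_eq_smul (α := Ω)
      intro a
      have : a ∈ fixedPoints (Subgroup.zpowers σ) Ω := huniv ▸ Set.mem_univ a
      simpa using this ⟨σ, Subgroup.mem_zpowers σ⟩
    rw [h1, orderOf_one] at hσ
    omega
  have hone : Nat.card (fixedPoints (Subgroup.zpowers σ) Ω) = 1 := by
    have : 6 % 5 = Nat.card (fixedPoints (Subgroup.zpowers σ) Ω) % 5 := hmod
    omega
  obtain ⟨⟨⟨ω, hω⟩⟩, hsub⟩ : Nonempty _ ∧ Subsingleton _ :=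
    (Nat.card_eq_one_iff_unique.mp hone).symm
  -- Since σ fixes ω and normalizes N, it preserves the N-orbit of ω. As ω is its only fixed point
  -- there, the orbit has size 1 modulo 5.
  let B : SubMulAction (Subgroup.zpowers σ) Ω :=
    { carrier := orbit N ω
      smul_mem' := by
        rintro g x ⟨n, rfl⟩
        refine ⟨⟨g * n * (g : G)⁻¹, hN.conj_mem _ n.2 _⟩, ?_⟩
        have hg : (g : G) • ω = ω := hω g
        change ((g : G) * n * (g : G)⁻¹) • ω = (g : G) • (n : G) • ω
        rw [mul_smul, mul_smul, inv_smul_eq_iff.mpr hg.symm] }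
  have hBmod := hp.card_modEq_card_fixedPoints B
  have hωB : ω ∈ B := mem_orbit_self ω
  have hB1 : Nat.card (fixedPoints (Subgroup.zpowers σ) B) = 1 := by
    rw [Nat.card_eq_one_iff_unique]
    refine ⟨⟨?_⟩, ⟨⟨⟨ω, hωB⟩, fun g => Subtype.ext (hω g)⟩⟩⟩
    have key : ∀ a : fixedPoints (Subgroup.zpowers σ) B, (a.1 : Ω) = ω := fun a => by
      have ha : (a.1 : Ω) ∈ fixedPoints (Subgroup.zpowers σ) Ω :=
        fun g => congrArg Subtype.val (a.2 g)
      exact congrArg Subtype.val (hsub.elim ⟨_, ha⟩ ⟨ω, hω⟩)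
    intro a b
    exact Subtype.ext (Subtype.ext ((key a).trans (key b).symm))
  have hBle : Nat.card B ≤ 6 := hΩ ▸ Nat.card_le_card_of_injective _ Subtype.val_injective
  have hB : Nat.card B = 1 ∨ Nat.card B = 6 := by
    rw [hB1] at hBmod
    have : Nat.card B % 5 = 1 % 5 := hBmod
    omega
  rcases hB with hB | hB
  · exfalso
    apply hN1
    have hBsub := (Nat.card_eq_one_iff_unique.mp hB).1
    have hfix : ∀ n ∈ N, n • ω = ω := fun n hn =>
      congrArg Subtype.val (hBsub.elim ⟨n • ω, ⟨⟨n, hn⟩, rfl⟩⟩ ⟨ω, hωB⟩)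
    rw [Subgroup.eq_bot_iff_forall]
    intro n hn
    apply FaithfulSMul.eq_of_smul_eq_smul (α := Ω)
    intro a
    obtain ⟨g, rfl⟩ := exists_smul_eq G ω a
    have := hfix _ (hN.conj_mem n hn g⁻¹)
    rw [inv_inv, mul_smul, mul_smul, inv_smul_eq_iff] at this
    rw [this, one_smul]
  · have huniv : orbit N ω = Set.univ := by
      apply Set.eq_of_subset_of_ncard_le (Set.subset_univ _)
      rw [Set.ncard_univ, hΩ, ← hB, ← Nat.card_coe_set_eq]
      exact le_refl _
    have : ∀ x, ∃ n : N, n • ω = x := fun x => (huniv ▸ Set.mem_univ x : x ∈ orbit N ω)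
    refine ⟨fun x y => ?_⟩
    obtain ⟨a, rfl⟩ := this x
    obtain ⟨b, rfl⟩ := this y
    exact ⟨b * a⁻¹, by rw [mul_smul, inv_smul_smul]⟩

/-- A faithful transitive action of a commutative group is regular. -/
theorem card_eq_of_commute_of_isPretransitive {G Ω : Type*} [Group G] [MulAction G Ω]
    [FaithfulSMul G Ω] [Nonempty Ω] (N : Subgroup G) (hN : ∀ a ∈ N, ∀ b ∈ N, a * b = b * a)
    [IsPretransitive N Ω] : Nat.card N = Nat.card Ω := by
  obtain ⟨ω⟩ := ‹Nonempty Ω›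
  refine Nat.card_congr (Equiv.ofBijective (fun n : N => n • ω) ⟨?_, exists_smul_eq N ω⟩)
  intro a b hab
  apply Subtype.ext
  apply FaithfulSMul.eq_of_smul_eq_smul (α := Ω)
  intro x
  obtain ⟨n, rfl⟩ := exists_smul_eq N ω x
  have hab : (a : G) • ω = (b : G) • ω := hab
  change (a : G) • (n : G) • ω = (b : G) • (n : G) • ω
  rw [smul_smul, smul_smul, hN _ a.2 _ n.2, hN _ b.2 _ n.2, mul_smul, mul_smul, hab]

/-- A nontrivial solvable group has a nontrivial commutative normal subgroup. -/
theorem exists_normal_commute_ne_bot {G : Type*} [Group G] [Nontrivial G] (h : Group.IsSolvable G) :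
    ∃ N : Subgroup G, N.Normal ∧ N ≠ ⊥ ∧ ∀ a ∈ N, ∀ b ∈ N, a * b = b * a := by
  classical
  -- The subgroup sought is the last nontrivial term of the derived series.
  have hex : ∃ n, derivedSeries G n = ⊥ := h.solvable
  obtain ⟨n, hn⟩ : ∃ n, Nat.find hex = n + 1 := by
    refine Nat.exists_eq_succ_of_ne_zero fun h0 => ?_
    have := Nat.find_spec hex
    rw [h0, derivedSeries_zero] at this
    exact top_ne_bot this
  have hbot := Nat.find_spec hex
  rw [hn, derivedSeries_succ, Subgroup.commutator_eq_bot_iff_le_centralizer] at hbot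
  refine ⟨derivedSeries G n, inferInstance, Nat.find_min hex (by omega), fun a ha b hb => ?_⟩
  exact (Subgroup.mem_centralizer_iff.mp (hbot ha) b hb).symm

/-- A group of order divisible by five that acts faithfully and transitively on six points is not
solvable. -/
theorem not_isSolvable_of_five_dvd_card {G Ω : Type*} [Group G] [Finite G]
    [MulAction G Ω] [FaithfulSMul G Ω] [IsPretransitive G Ω] (hΩ : Nat.card Ω = 6)
    (h5 : 5 ∣ Nat.card G) : ¬ Group.IsSolvable G := by
  intro hsol
  have : Finite Ω := Nat.finite_of_card_ne_zero (by omega)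
  have : Nonempty Ω := (Nat.card_pos_iff.mp (by omega)).1
  have : Nontrivial G := by
    have := Nat.le_of_dvd Nat.card_pos h5
    exact Finite.one_lt_card_iff_nontrivial.mp (by omega)
  have hcard : ∀ N : Subgroup G, N.Normal → N ≠ ⊥ → (∀ a ∈ N, ∀ b ∈ N, a * b = b * a) →
      Nat.card N = 6 := fun N hN hN1 hc => by
    have := isPretransitive_of_normal_of_five_dvd_card hΩ h5 N hN1
    rw [card_eq_of_commute_of_isPretransitive (Ω := Ω) N hc, hΩ]
  obtain ⟨A, hA, hA1, hAc⟩ := exists_normal_commute_ne_bot hsol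
  -- A has order 6, and so would its 2-torsion T, which is again normal, abelian and nontrivial; but
  -- then T would contain an element of order 3.
  let T : Subgroup G :=
    { carrier := {a | a ∈ A ∧ a ^ 2 = 1}
      one_mem' := ⟨A.one_mem, one_pow 2⟩
      mul_mem' := fun {a b} ha hb =>
        ⟨A.mul_mem ha.1 hb.1, by
          rw [Commute.mul_pow (hAc a ha.1 b hb.1), ha.2, hb.2, one_mul]⟩
      inv_mem' := fun {a} ha => ⟨A.inv_mem ha.1, by rw [inv_pow, ha.2, inv_one]⟩ }
  have hT : T.Normal := ⟨fun a ha g => ⟨hA.conj_mem a ha.1 g, by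
    rw [conj_pow, ha.2, mul_one, mul_inv_cancel]⟩⟩
  have hA6 := hcard A hA hA1 hAc
  have : Fact (Nat.Prime 2) := ⟨by norm_num⟩
  have : Fact (Nat.Prime 3) := ⟨by norm_num⟩
  have hT1 : T ≠ ⊥ := by
    obtain ⟨a, ha⟩ := exists_prime_orderOf_dvd_card' (G := A) 2 (by rw [hA6]; norm_num)
    intro h
    have haT : (a : G) ∈ T := ⟨a.2, by
      have := pow_orderOf_eq_one a
      rw [ha] at this
      exact congrArg Subtype.val this⟩
    rw [h, Subgroup.mem_bot, OneMemClass.coe_eq_one] at haT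
    rw [haT, orderOf_one] at ha
    omega
  have hT6 := hcard T hT hT1 fun a ha b hb => hAc a ha.1 b hb.1
  obtain ⟨a, ha⟩ := exists_prime_orderOf_dvd_card' (G := T) 3 (by rw [hT6]; norm_num)
  have h2 : a ^ 2 = 1 := Subtype.ext a.2.2
  have := orderOf_dvd_of_pow_eq_one h2
  rw [ha] at this
  omega

/-! ### Factors modulo p and the order of the Galois group -/

/-- If a monic integer polynomial splits in a Galois number field, then the degree of each of its
irreducible factors modulo `p` divides the order of the Galois group. -/
theorem natDegree_dvd_card_galois {f : ℤ[X]} (hf : f.Monic) (p : ℕ) [Fact p.Prime]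
    {q : (ZMod p)[X]} (hq : Irreducible q) (hqf : q ∣ f.map (Int.castRingHom (ZMod p)))
    (L : Type*) [Field L] [NumberField L] [IsGalois ℚ L] (hL : (f.map (Int.castRingHom L)).Splits) :
    q.natDegree ∣ Nat.card Gal(L/ℚ) := by
  have : IsGaloisGroup Gal(L/ℚ) ℤ (NumberField.RingOfIntegers L) :=
    IsGaloisGroup.of_isFractionRing Gal(L/ℚ) ℤ (NumberField.RingOfIntegers L) ℚ L
  let P : Ideal ℤ := Ideal.span {(p : ℤ)}
  have hP : P.IsMaximal := Int.ideal_span_isMaximal_of_prime p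
  obtain ⟨Q, hQ, hQP⟩ :=
    Ideal.exists_maximal_ideal_liesOver_of_isIntegral (S := NumberField.RingOfIntegers L) P
  -- The order of the group is the number of primes above p times the ramification index times the
  -- residue degree, so only the residue degree matters.
  have hdvd : Q.inertiaDeg ℤ ∣ Nat.card Gal(L/ℚ) := by
    rw [← Ideal.ncard_primesOver_mul_ramificationIdxIn_mul_inertiaDegIn P
      (NumberField.RingOfIntegers L) Gal(L/ℚ),
      Ideal.inertiaDegIn_eq_inertiaDeg P Q Gal(L/ℚ), ← mul_assoc]
    exact dvd_mul_left _ _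
  refine dvd_trans ?_ hdvd
  rw [Ideal.inertiaDeg_eq_of_isMaximal P Q]
  let k := NumberField.RingOfIntegers L ⧸ Q
  let : Field k := Ideal.Quotient.field Q
  have hpk : ((p : ℕ) : k) = 0 := by
    have hmem : algebraMap ℤ (NumberField.RingOfIntegers L) (p : ℤ) ∈ Q :=
      (Ideal.mem_of_liesOver Q P (p : ℤ)).mp (Ideal.mem_span_singleton_self _)
    have := Ideal.Quotient.eq_zero_iff_mem.mpr hmem
    simpa using this
  have : CharP k p := by
    obtain ⟨c, hc⟩ := CharP.exists k
    have := (CharP.cast_eq_zero_iff k c p).mp hpk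
    rcases (Nat.dvd_prime Fact.out).mp this with h | h
    · exact absurd h (CharP.char_ne_one k c)
    · exact h ▸ hc
  let : Algebra (ZMod p) k := ZMod.algebra k p
  have hfin : Module.finrank (ℤ ⧸ P) k = Module.finrank (ZMod p) k :=
    Algebra.finrank_eq_of_equiv_equiv (Int.quotientSpanNatEquivZMod p) (RingEquiv.refl k)
      (Ideal.Quotient.ringHom_ext (RingHom.ext_int _ _))
  change q.natDegree ∣ Module.finrank (ℤ ⧸ P) k
  rw [hfin]
  -- The roots of f are integral, so the splitting already takes place in the ring of integers and
  -- can be reduced modulo Q. A root of q in the residue field then has degree `q.natDegree` over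
  -- `ZMod p`.
  have hsplit : (f.map (algebraMap ℤ (NumberField.RingOfIntegers L))).Splits := by
    have hcomp : (algebraMap (NumberField.RingOfIntegers L) L).comp
        (algebraMap ℤ (NumberField.RingOfIntegers L)) = Int.castRingHom L := RingHom.ext_int _ _
    refine Splits.of_splits_map_of_injective
      (i := algebraMap (NumberField.RingOfIntegers L) L)
      (FaithfulSMul.algebraMap_injective _ _) ?_ ?_
    · rwa [Polynomial.map_map, hcomp]
    · intro a ha
      have ha0 := (mem_roots'.mp ha).2
      rw [Polynomial.map_map, hcomp, IsRoot.def, eval_map] at ha0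
      exact ⟨⟨a, f, hf, ha0⟩, rfl⟩
  have hsplit' : ((f.map (Int.castRingHom (ZMod p))).map (algebraMap (ZMod p) k)).Splits := by
    have := hsplit.map (Ideal.Quotient.mk Q)
    rw [Polynomial.map_map] at this ⊢
    rwa [RingHom.ext_int ((algebraMap (ZMod p) k).comp (Int.castRingHom (ZMod p)))]
  obtain ⟨α, hα⟩ := (hsplit'.of_dvd ((hf.map _).map _).ne_zero
    (Polynomial.map_dvd (algebraMap (ZMod p) k) hqf)).exists_eval_eq_zero (by
      rw [degree_map]
      exact (degree_pos_of_irreducible hq).ne')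
  have hα' : aeval α q = 0 := by rwa [aeval_def, ← eval_map]
  have : Module.Finite (ZMod p) k := by
    have : Finite k := Ideal.finiteQuotientOfFreeOfNeBot Q (by
      rintro rfl
      have h0 : (algebraMap ℤ (NumberField.RingOfIntegers L)) (p : ℤ) = 0 := by
        rw [← Ideal.mem_bot]
        exact (Ideal.mem_of_liesOver ⊥ P (p : ℤ)).mp (Ideal.mem_span_singleton_self _)
      have : p ≠ 0 := (Fact.out : p.Prime).ne_zero
      simp at h0
      exact this h0)
    exact Module.Finite.of_finite
  have hmin := minpoly.eq_of_irreducible hq hα'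
  have hdeg : q.natDegree = (minpoly (ZMod p) α).natDegree := by
    rw [← hmin, natDegree_mul_C (inv_ne_zero (leadingCoeff_ne_zero.mpr hq.ne_zero))]
  rw [hdeg]
  exact minpoly.degree_dvd (Algebra.IsIntegral.isIntegral α)

/-- The degree of an irreducible factor modulo `p` of a monic integer polynomial divides the order
of its Galois group over `ℚ`. -/
theorem natDegree_dvd_card_gal {f : ℤ[X]} (hf : f.Monic) (p : ℕ) [Fact p.Prime] {q : (ZMod p)[X]}
    (hq : Irreducible q) (hqf : q ∣ f.map (Int.castRingHom (ZMod p))) :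
    q.natDegree ∣ Nat.card (f.map (Int.castRingHom ℚ)).Gal := by
  let g := f.map (Int.castRingHom ℚ)
  -- The splitting field carries its own `ℚ`-algebra structure. Generalizing over it allows the
  -- replacement by the canonical one of a field of characteristic zero.
  suffices h : ∀ (L : Type) [Field L] [CharZero L] [A : Algebra ℚ L] [IsSplittingField ℚ L g],
      q.natDegree ∣ Nat.card Gal(L/ℚ) by
    have : CharZero g.SplittingField := algebraRat.charZero _
    exact @h g.SplittingField _ this _ (IsSplittingField.splittingField g)
  intro L _ _ A _
  obtain rfl : A = DivisionRing.toRatAlgebra := Subsingleton.elim _ _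
  have : FiniteDimensional ℚ L := IsSplittingField.finiteDimensional L g
  have : NumberField L := ⟨⟩
  have : Normal ℚ L := Normal.of_isSplittingField g
  have : IsGalois ℚ L := { __ := this }
  refine natDegree_dvd_card_galois hf p hq hqf L ?_
  have := IsSplittingField.splits L g
  rwa [Polynomial.map_map,
    RingHom.ext_int ((algebraMap ℚ L).comp (Int.castRingHom ℚ)) (Int.castRingHom L)] at this

/-! ### The sextic and its Galois group -/

theorem quintic_ne_zero_zmod_seventeen :
    ∀ x : ZMod 17, x ^ 5 + 9 * x ^ 4 + 13 * x ^ 3 + x ^ 2 + 11 * x + 1 ≠ 0 := by decide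

set_option maxRecDepth 20000 in
-- Long division of the quintic by x^2 + a x + b determines the cubic quotient from the three
-- highest coefficients below the leading one. The two equations compare the constant and linear
-- coefficients, which never match simultaneously.
theorem quadratic_remainder_zmod_seventeen : ∀ a b : ZMod 17,
    (1 - (13 - b - (9 - a) * a) * a - (9 - a) * b) * b = 1 →
    (1 - (13 - b - (9 - a) * a) * a - (9 - a) * b) * a + (13 - b - (9 - a) * a) * b ≠ 11 := by
  decide

/-- A quintic with neither a linear nor a quadratic factor. -/
theorem irreducible_quintic_zmod_seventeen :
    Irreducible (X ^ 5 + C 9 * X ^ 4 + C 13 * X ^ 3 + X ^ 2 + C 11 * X + 1 : (ZMod 17)[X]) := by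
  have : Fact (Nat.Prime 17) := ⟨by norm_num⟩
  set q : (ZMod 17)[X] := X ^ 5 + C 9 * X ^ 4 + C 13 * X ^ 3 + X ^ 2 + C 11 * X + 1 with hq
  have hdeg : q.natDegree = 5 := by rw [hq]; compute_degree!
  have hmon : q.Monic := by rw [hq]; monicity!
  rw [hmon.irreducible_iff_natDegree']
  refine ⟨fun h => by simp [h] at hdeg, ?_⟩
  rintro f g hf hg hfg hgdeg
  rw [hdeg, Finset.mem_Ioc] at hgdeg
  have hfdeg : f.natDegree + g.natDegree = 5 := by
    rw [← hdeg, ← hfg, hf.natDegree_mul hg]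
  have hg2 : g.natDegree = 1 ∨ g.natDegree = 2 := by omega
  have hcoeff : ∀ n, (f * g).coeff n = q.coeff n := fun n => by rw [hfg]
  rcases hg2 with h | h
  · have hroot : q.eval (-g.coeff 0) = 0 := by
      rw [← hfg, eval_mul, hg.as_sum, h]
      simp
    apply quintic_ne_zero_zmod_seventeen (-g.coeff 0)
    rw [hq] at hroot
    simpa using hroot
  · have h3 : f.natDegree = 3 := by omega
    have hf3 : f.coeff 3 = 1 := by rw [← h3]; exact hf
    have hg2 : g.coeff 2 = 1 := by rw [← h]; exact hg
    have hf4 : ∀ n, 3 < n → f.coeff n = 0 := fun n hn => coeff_eq_zero_of_natDegree_lt (by omega)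
    have hg3 : ∀ n, 2 < n → g.coeff n = 0 := fun n hn => coeff_eq_zero_of_natDegree_lt (by omega)
    have e0 := hcoeff 0
    have e1 := hcoeff 1
    have e2 := hcoeff 2
    have e3 := hcoeff 3
    have e4 := hcoeff 4
    simp [hq, coeff_mul, Finset.Nat.antidiagonal_succ, coeff_X, coeff_one, hf3, hg2, hf4, hg3] at e0 e1 e2 e3 e4
    generalize f.coeff 0 = e at *
    generalize f.coeff 1 = d at *
    generalize f.coeff 2 = c at *
    generalize g.coeff 0 = b at *
    generalize g.coeff 1 = a at *
    obtain rfl : c = 9 - a := by linear_combination e4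
    obtain rfl : d = 13 - b - (9 - a) * a := by linear_combination e3
    obtain rfl : e = 1 - (13 - b - (9 - a) * a) * a - (9 - a) * b := by linear_combination e2
    exact quadratic_remainder_zmod_seventeen a b e0 e1

/-- A monic sextic over `ℤ` whose Galois group is not solvable. -/
noncomputable def sextic : ℤ[X] :=
  X ^ 6 + C 84 * X ^ 5 + C 1470 * X ^ 4 - C 2628 * X ^ 3 - C 242487 * X ^ 2 - C 1428840 * X
    - C 2834352

theorem natDegree_sextic : sextic.natDegree = 6 := by rw [sextic]; compute_degree!

theorem monic_sextic : sextic.Monic := by rw [sextic]; monicity!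

theorem sextic_map_zmod_seventeen : sextic.map (Int.castRingHom (ZMod 17)) =
    (X - C 10) * (X ^ 5 + C 9 * X ^ 4 + C 13 * X ^ 3 + X ^ 2 + C 11 * X + 1) := by
  have h17 : (17 : (ZMod 17)[X]) = 0 := by
    rw [← map_ofNat C, show (OfNat.ofNat 17 : ZMod 17) = 0 from rfl, map_zero]
  simp only [sextic, Polynomial.map_add, Polynomial.map_sub, Polynomial.map_mul, Polynomial.map_pow,
    map_X, map_ofNat, Polynomial.map_ofNat]
  -- The multiplier is the difference of the integer lifts of both sides, divided by 17.
  linear_combination (5 * X ^ 5 + 91 * X ^ 4 - 147 * X ^ 3 - 14264 * X ^ 2 - 84043 * X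
    - 166726) * h17

theorem sextic_ne_zero_zmod_eleven : ∀ x : ZMod 11,
    x ^ 6 + 84 * x ^ 5 + 1470 * x ^ 4 - 2628 * x ^ 3 - 242487 * x ^ 2 - 1428840 * x
      - 2834352 ≠ 0 := by decide

/-- A proper factorization has a factor of degree at most 3. Degree 1 is excluded by the absence of
roots modulo 11. Modulo 17 the factor is coprime to the irreducible quintic, so it divides the
linear factor, which excludes degrees 2 and 3. -/
theorem irreducible_sextic : Irreducible sextic := by
  have : Fact (Nat.Prime 17) := ⟨by norm_num⟩
  rw [monic_sextic.irreducible_iff_natDegree']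
  refine ⟨fun h => by simpa [h] using natDegree_sextic, ?_⟩
  rintro f g hf hg hfg hgdeg
  rw [natDegree_sextic, Finset.mem_Ioc] at hgdeg
  have hg1 : g.natDegree ≠ 1 := by
    intro h
    have hroot : sextic.eval (-g.coeff 0) = 0 := by
      rw [← hfg, eval_mul, hg.as_sum, h]
      simp
    apply sextic_ne_zero_zmod_eleven ((-g.coeff 0 : ℤ) : ZMod 11)
    have := congrArg (Int.cast : ℤ → ZMod 11) hroot
    simpa [sextic] using this
  set q : (ZMod 17)[X] := X ^ 5 + C 9 * X ^ 4 + C 13 * X ^ 3 + X ^ 2 + C 11 * X + 1 with hq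
  have hqdeg : q.natDegree = 5 := by rw [hq]; compute_degree!
  have hqirr : Irreducible q := irreducible_quintic_zmod_seventeen
  let g' := g.map (Int.castRingHom (ZMod 17))
  have hg' : g'.natDegree = g.natDegree := hg.natDegree_map _
  have hg'0 : g' ≠ 0 := (hg.map _).ne_zero
  have hdvd : g' ∣ (X - C 10) * q := by
    rw [← sextic_map_zmod_seventeen, ← hfg, Polynomial.map_mul]
    exact dvd_mul_left _ _
  have hcop : IsCoprime g' q := by
    refine IsCoprime.symm ((hqirr.coprime_iff_not_dvd).mpr fun h => ?_)
    have := natDegree_le_of_dvd h hg'0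
    omega
  have hle := natDegree_le_of_dvd (hcop.dvd_of_dvd_mul_right hdvd) (X_sub_C_ne_zero 10)
  rw [natDegree_X_sub_C] at hle
  omega

theorem irreducible_sextic_rat : Irreducible (sextic.map (Int.castRingHom ℚ)) :=
  monic_sextic.irreducible_iff_irreducible_map_fraction_map.mp irreducible_sextic

theorem not_isSolvable_gal_sextic :
    ¬ Group.IsSolvable (sextic.map (Int.castRingHom ℚ)).Gal := by
  have : Fact (Nat.Prime 17) := ⟨by norm_num⟩
  set g := sextic.map (Int.castRingHom ℚ)
  have hsplit := SplittingField.splits g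
  have : Fact ((g.map (algebraMap ℚ g.SplittingField)).Splits) := ⟨hsplit⟩
  have : MulAction.IsPretransitive g.Gal (g.rootSet g.SplittingField) :=
    Gal.galAction_isPretransitive g g.SplittingField irreducible_sextic_rat
  have : FaithfulSMul g.Gal (g.rootSet g.SplittingField) :=
    ⟨fun h => Gal.galActionHom_injective g g.SplittingField (Equiv.ext h)⟩
  refine not_isSolvable_of_five_dvd_card (Ω := g.rootSet g.SplittingField) ?_ ?_
  · rw [Nat.card_eq_fintype_card]
    exact (card_rootSet_eq_natDegree irreducible_sextic_rat.separable hsplit).trans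
      ((monic_sextic.natDegree_map _).trans natDegree_sextic)
  · have h := natDegree_dvd_card_gal monic_sextic 17 irreducible_quintic_zmod_seventeen
      (sextic_map_zmod_seventeen ▸ dvd_mul_left _ _)
    have hdeg : (X ^ 5 + C 9 * X ^ 4 + C 13 * X ^ 3 + X ^ 2 + C 11 * X + 1 :
      (ZMod 17)[X]).natDegree = 5 := by compute_degree!
    rwa [hdeg] at h

/-- A root of the sextic is not expressible by radicals. -/
theorem notMem_solvableByRad_of_sextic_eq_zero {z : ℂ}
    (hz : z ^ 6 + 84 * z ^ 5 + 1470 * z ^ 4 - 2628 * z ^ 3 - 242487 * z ^ 2 - 1428840 * z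
      - 2834352 = 0) : z ∉ solvableByRad ℚ ℂ := by
  intro h
  refine not_isSolvable_gal_sextic (isSolvable_gal_of_irreducible h irreducible_sextic_rat ?_)
  simpa [sextic, map_ofNat] using hz

/-! ### The cost of a symmetric pair of points -/

/-- Twice the least cost that the points `x` and `-x` contribute for the means `c + h` and `c - h`,
as a function of `q = c ^ 2` and `t = h ^ 2`. -/
noncomputable def pairCost (x q t : ℝ) : ℝ :=
  2 * (x ^ 2 + q - 3 * t) +
    8 * t ^ 2 * (x ^ 2 + q + t) / ((q + t - x ^ 2) ^ 2 + 4 * x ^ 2 * t)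

theorem pairCost_denom_pos {x q t : ℝ} (hx : x ≠ 0) (ht : 0 < t) :
    0 < (q + t - x ^ 2) ^ 2 + 4 * x ^ 2 * t :=
  add_pos_of_nonneg_of_pos (sq_nonneg _) (mul_pos (mul_pos four_pos (sq_pos_iff.mpr hx)) ht)

theorem pointCost_add_pointCost_neg {x c t : ℝ} (ht : 0 < t) :
    ((x - c) ^ 2 - t) ^ 2 / ((x - c) ^ 2 + t) + ((-x - c) ^ 2 - t) ^ 2 / ((-x - c) ^ 2 + t) =
      pairCost x (c ^ 2) t := by
  have h1 : (x - c) ^ 2 + t ≠ 0 := by positivity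
  have h2 : (-x - c) ^ 2 + t ≠ 0 := by positivity
  have h3 : (c ^ 2 + t - x ^ 2) ^ 2 + 4 * x ^ 2 * t = ((x - c) ^ 2 + t) * ((-x - c) ^ 2 + t) := by
    ring
  rw [pairCost, h3]
  field_simp
  ring

theorem pairCost_nonneg {x q t : ℝ} (hq : 0 ≤ q) (ht : 0 < t) :
    0 ≤ pairCost x q t := by
  have := pointCost_add_pointCost_neg (x := x) (c := √q) ht
  rw [Real.sq_sqrt hq] at this
  rw [← this]
  positivity

theorem pairCost_zero {x t : ℝ} (hx : 0 < x) (ht : 0 < t) :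
    pairCost x 0 t = 2 * t - 6 * x ^ 2 + 8 * t ^ 2 / (x ^ 2 + t) + 8 * (x ^ 2 - t) := by
  have h1 : x ^ 2 + t ≠ 0 := by positivity
  have h3 : (0 + t - x ^ 2) ^ 2 + 4 * x ^ 2 * t = (x ^ 2 + t) ^ 2 := by ring
  rw [pairCost, h3]
  field_simp
  ring

/-- The contribution of a pair decreases at most linearly in `q`. -/
theorem pairCost_zero_add_le {x q t κ : ℝ} (hx : 0 < x) (hκ : 0 < κ) (hq : 0 ≤ q) (ht : 0 < t)
    (h : 4 * t ^ 3 ≤ κ * (x ^ 2 + t) * x ^ 2 * (4 * t + κ * (x ^ 2 + t))) :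
    pairCost x 0 t + (2 - κ) * q ≤ pairCost x q t := by
  have hs : 0 < x ^ 2 + t := by positivity
  have hE := pairCost_denom_pos (q := q) hx.ne' ht
  have h0 : (0 + t - x ^ 2) ^ 2 + 4 * x ^ 2 * t = (x ^ 2 + t) ^ 2 := by ring
  -- After multiplication by κ (x^2 + t) this is a quadratic in q; completing the square leaves 4 t
  -- times the slack in `h`.
  have hkey : 0 ≤ κ * (x ^ 2 + t) * ((q + t - x ^ 2) ^ 2 + 4 * x ^ 2 * t)
      - 8 * t ^ 2 * (q + t - 3 * x ^ 2) := by
    have hκs : 0 < κ * (x ^ 2 + t) := by positivity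
    refine (mul_nonneg_iff_of_pos_left hκs).mp ?_
    nlinarith [sq_nonneg (κ * (x ^ 2 + t) * (q + t - x ^ 2) - 4 * t ^ 2),
      mul_le_mul_of_nonneg_left h ht.le]
  have hid : pairCost x q t - (pairCost x 0 t + (2 - κ) * q) =
      q * (κ * (x ^ 2 + t) * ((q + t - x ^ 2) ^ 2 + 4 * x ^ 2 * t)
      - 8 * t ^ 2 * (q + t - 3 * x ^ 2)) /
        ((x ^ 2 + t) * ((q + t - x ^ 2) ^ 2 + 4 * x ^ 2 * t)) := by
    rw [pairCost, pairCost, h0]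
    field_simp
    ring
  have : 0 ≤ pairCost x q t - (pairCost x 0 t + (2 - κ) * q) := by
    rw [hid]
    positivity
  linarith

theorem lt_pairCost {x q t b : ℝ} (hx : 0 < x) (ht : 0 < t)
    (h : 0 < 2 * (x ^ 2 + q + t) * (x ^ 2 + q - t) ^ 2 - 8 * x ^ 2 * q * (x ^ 2 + q - 3 * t)
      - b * ((q + t - x ^ 2) ^ 2 + 4 * x ^ 2 * t)) : b < pairCost x q t := by
  have hE := pairCost_denom_pos (q := q) hx.ne' ht
  have hid : pairCost x q t - b =
      (2 * (x ^ 2 + q + t) * (x ^ 2 + q - t) ^ 2 - 8 * x ^ 2 * q * (x ^ 2 + q - 3 * t)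
      - b * ((q + t - x ^ 2) ^ 2 + 4 * x ^ 2 * t)) / ((q + t - x ^ 2) ^ 2 + 4 * x ^ 2 * t) := by
    rw [pairCost]
    field_simp
    ring
  have : 0 < pairCost x q t - b := by
    rw [hid]
    positivity
  linarith

/-! ### Minimizing the total cost over q and t -/

/-- Twice the least cost of the points `±1, ±2, ±3` for the means `c + h` and `c - h`, as a function
of `q = c ^ 2` and `t = h ^ 2`. -/
noncomputable def totalCost (q t : ℝ) : ℝ := pairCost 1 q t + pairCost 2 q t + pairCost 3 q t

/-- The pair ±1 may decrease in q, but the other two compensate: the values of κ add up to 59/10 <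
6, so the slopes 2 - κ have sum 1/10. The bound t ≤ 9 makes the three choices of κ admissible. -/
theorem totalCost_zero_lt {q t : ℝ} (hq : 0 < q) (ht : 0 < t) (ht9 : t ≤ 9) :
    totalCost 0 t < totalCost q t := by
  have h1 := pairCost_zero_add_le (x := 1) (κ := 21 / 5) (by norm_num) (by norm_num) hq.le ht (by
    nlinarith [mul_nonneg ht.le (sub_nonneg.mpr ht9),
      mul_nonneg (mul_nonneg ht.le ht.le) (sub_nonneg.mpr ht9)])
  have h2 := pairCost_zero_add_le (x := 2) (κ := 6 / 5) (by norm_num) (by norm_num) hq.le ht (by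
    nlinarith [mul_nonneg ht.le (sub_nonneg.mpr ht9),
      mul_nonneg (mul_nonneg ht.le ht.le) (sub_nonneg.mpr ht9)])
  have h3 := pairCost_zero_add_le (x := 3) (κ := 1 / 2) (by norm_num) (by norm_num) hq.le ht (by
    nlinarith [mul_nonneg ht.le (sub_nonneg.mpr ht9),
      mul_nonneg (mul_nonneg ht.le ht.le) (sub_nonneg.mpr ht9)])
  rw [totalCost, totalCost]
  linarith

/-- A single pair already exceeds the bound: ±1 if q ≤ 2, and ±2 if q ≥ 2. The constant 149/20 lies
just above `totalCost 0 4`, which bounds the minimum from above. -/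
theorem lt_totalCost_of_nine_le {q t : ℝ} (hq : 0 ≤ q) (ht : 9 ≤ t) : 149 / 20 < totalCost q t := by
  have ht0 : 0 < t := by linarith
  have h1 := pairCost_nonneg (x := 1) hq ht0
  have h2 := pairCost_nonneg (x := 2) hq ht0
  have h3 := pairCost_nonneg (x := 3) hq ht0
  rw [totalCost]
  obtain ⟨s, rfl⟩ : ∃ s, t = 9 + s := ⟨t - 9, by ring⟩
  have hs : 0 ≤ s := by linarith
  rcases le_total q 2 with hq2 | hq2
  · obtain ⟨p, rfl⟩ : ∃ p, q = 2 - p := ⟨2 - q, by ring⟩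
    have hp : 0 ≤ p := by linarith
    have hp2 : 0 ≤ 2 - p := by linarith
    have := lt_pairCost (x := 1) (q := 2 - p) (t := 9 + s) (b := 149 / 20) (by norm_num) ht0 (by
      nlinarith [mul_nonneg hp hp2, mul_nonneg (mul_nonneg hp hp2) hs,
        mul_nonneg (mul_nonneg hp hp2) hp, mul_nonneg hp hs, mul_nonneg hp2 hs,
        mul_nonneg hp (sq_nonneg s), pow_nonneg hs 3, sq_nonneg s])
    linarith
  · obtain ⟨p, rfl⟩ : ∃ p, q = 2 + p := ⟨q - 2, by ring⟩
    have hp : 0 ≤ p := by linarith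
    have := lt_pairCost (x := 2) (q := 2 + p) (t := 9 + s) (b := 149 / 20) (by norm_num) ht0 (by
      nlinarith [mul_nonneg hp (sq_nonneg (s - p + 27 / 5)), mul_nonneg hs (sq_nonneg (s - p)),
        sq_nonneg (p - 5 / 3 * s), sq_nonneg s])
    linarith

theorem totalCost_zero_eq {t : ℝ} (ht : 0 < t) :
    totalCost 0 t = 6 * t - 84 + 8 * (1 / (1 + t) + 16 / (4 + t) + 81 / (9 + t)) := by
  have h1 : 1 + t ≠ 0 := by positivity
  have h2 : 4 + t ≠ 0 := by positivity
  have h3 : 9 + t ≠ 0 := by positivity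
  have e1 : pairCost 1 0 t = 2 * t - 6 + 8 * (1 / (1 + t)) := by
    rw [pairCost_zero one_pos ht]
    field_simp
    ring
  have e2 : pairCost 2 0 t = 2 * t - 24 + 8 * (16 / (4 + t)) := by
    rw [pairCost_zero two_pos ht, show (2 : ℝ) ^ 2 = 4 by norm_num]
    field_simp
    ring
  have e3 : pairCost 3 0 t = 2 * t - 54 + 8 * (81 / (9 + t)) := by
    rw [pairCost_zero three_pos ht, show (3 : ℝ) ^ 2 = 9 by norm_num]
    field_simp
    ring
  rw [totalCost, e1, e2, e3]
  ring

/-- At a critical point, the function `t ↦ totalCost 0 t` attains its minimum. -/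
theorem totalCost_zero_add_le {t t₀ : ℝ} (ht : 0 < t) (ht₀ : 0 < t₀)
    (hcrit : 3 = 4 * (1 / (1 + t₀) ^ 2 + 16 / (4 + t₀) ^ 2 + 81 / (9 + t₀) ^ 2)) :
    totalCost 0 t₀ + 8 * (t - t₀) ^ 2 / ((1 + t) * (1 + t₀) ^ 2) ≤ totalCost 0 t := by
  -- The gap between the convex function w / (a + t) and its tangent at t₀. By `hcrit` the tangents
  -- cancel the linear term 6 t; only the gap for a = 1 is kept, which suffices for uniqueness.
  have hid : ∀ a w : ℝ, 0 < a → w / (a + t) - w / (a + t₀) + w / (a + t₀) ^ 2 * (t - t₀) =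
      w * (t - t₀) ^ 2 / ((a + t) * (a + t₀) ^ 2) := by
    intro a w ha
    have h1 : a + t ≠ 0 := by positivity
    have h2 : a + t₀ ≠ 0 := by positivity
    field_simp
    ring
  have i1 := hid 1 1 (by norm_num)
  have i2 := hid 4 16 (by norm_num)
  have i3 := hid 9 81 (by norm_num)
  have p2 : 0 ≤ 16 * (t - t₀) ^ 2 / ((4 + t) * (4 + t₀) ^ 2) := by positivity
  have p3 : 0 ≤ 81 * (t - t₀) ^ 2 / ((9 + t) * (9 + t₀) ^ 2) := by positivity
  have hsum : 6 * (t - t₀) = 8 * (1 / (1 + t₀) ^ 2 * (t - t₀) + 16 / (4 + t₀) ^ 2 * (t - t₀) +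
      81 / (9 + t₀) ^ 2 * (t - t₀)) := by
    linear_combination 2 * (t - t₀) * hcrit
  rw [totalCost_zero_eq ht, totalCost_zero_eq ht₀]
  have : 8 * (t - t₀) ^ 2 / ((1 + t) * (1 + t₀) ^ 2) =
      8 * (1 * (t - t₀) ^ 2 / ((1 + t) * (1 + t₀) ^ 2)) := by ring
  rw [this]
  linarith

/-- The sextic arises from the critical equation by clearing denominators and changes sign between 4
and 5. -/
theorem exists_critical_point : ∃ t : ℝ, 0 < t ∧
    3 = 4 * (1 / (1 + t) ^ 2 + 16 / (4 + t) ^ 2 + 81 / (9 + t) ^ 2) ∧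
    3 * t ^ 6 + 84 * t ^ 5 + 490 * t ^ 4 - 292 * t ^ 3 - 8981 * t ^ 2 - 17640 * t - 11664 = 0 := by
  obtain ⟨t, ht, h⟩ := intermediate_value_Icc (show (4 : ℝ) ≤ 5 by norm_num)
    (f := fun t : ℝ => 3 * t ^ 6 + 84 * t ^ 5 + 490 * t ^ 4 - 292 * t ^ 3 - 8981 * t ^ 2
      - 17640 * t - 11664) (by fun_prop) (show (0 : ℝ) ∈ _ by constructor <;> norm_num)
  have ht0 : 0 < t := by linarith [ht.1]
  refine ⟨t, ht0, ?_, h⟩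
  have h1 : 1 + t ≠ 0 := by positivity
  have h2 : 4 + t ≠ 0 := by positivity
  have h3 : 9 + t ≠ 0 := by positivity
  simp only at h
  field_simp
  linear_combination h

theorem totalCost_critical_lt {t₀ : ℝ} (ht₀ : 0 < t₀)
    (hcrit : 3 = 4 * (1 / (1 + t₀) ^ 2 + 16 / (4 + t₀) ^ 2 + 81 / (9 + t₀) ^ 2)) :
    totalCost 0 t₀ < 149 / 20 := by
  have h := totalCost_zero_add_le (t := 4) (by norm_num) ht₀ hcrit
  have h4 : totalCost 0 4 < 149 / 20 := by
    rw [totalCost_zero_eq (by norm_num)]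
    norm_num
  have : 0 ≤ 8 * (4 - t₀) ^ 2 / ((1 + 4) * (1 + t₀) ^ 2) := by positivity
  linarith

/-- The least cost is attained only for the symmetric means determined by the critical point. -/
theorem totalCost_critical_le {t₀ q t : ℝ} (ht₀ : 0 < t₀)
    (hcrit : 3 = 4 * (1 / (1 + t₀) ^ 2 + 16 / (4 + t₀) ^ 2 + 81 / (9 + t₀) ^ 2))
    (hq : 0 ≤ q) (ht : 0 < t) :
    totalCost 0 t₀ ≤ totalCost q t ∧ (totalCost q t ≤ totalCost 0 t₀ → q = 0 ∧ t = t₀) := by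
  rcases le_total 9 t with ht9 | ht9
  · have := totalCost_critical_lt ht₀ hcrit
    have := lt_totalCost_of_nine_le hq ht9
    exact ⟨by linarith, fun h => by linarith⟩
  · have hsym := totalCost_zero_add_le ht ht₀ hcrit
    have hpos : 0 ≤ 8 * (t - t₀) ^ 2 / ((1 + t) * (1 + t₀) ^ 2) := by positivity
    rcases hq.eq_or_lt with rfl | hq
    · refine ⟨by linarith, fun h => ⟨rfl, ?_⟩⟩
      by_contra hne
      have : t - t₀ ≠ 0 := sub_ne_zero.mpr hne
      have : 0 < 8 * (t - t₀) ^ 2 / ((1 + t) * (1 + t₀) ^ 2) := by positivity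
      linarith
    · have := totalCost_zero_lt hq ht ht9
      exact ⟨by linarith, fun h => by linarith⟩

/-! ### Numbers expressible by radicals -/

/-- The real numbers that are expressible by radicals. -/
noncomputable def radicalSubfield : Subfield ℝ :=
  (solvableByRad ℚ ℂ).toSubfield.comap Complex.ofRealHom

theorem mem_radicalSubfield {a : ℝ} : a ∈ radicalSubfield ↔ ExpressibleByRadicals a := Iff.rfl

theorem mem_radicalSubfield_of_sq_mem {a : ℝ} (h : a ^ 2 ∈ radicalSubfield) :
    a ∈ radicalSubfield := by
  refine solvableByRad.rad_mem (n := 2) two_ne_zero ?_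
  rw [mem_radicalSubfield, ExpressibleByRadicals, Complex.ofReal_pow] at h
  exact h

theorem notMem_radicalSubfield_of_sextic {t : ℝ}
    (h : 3 * t ^ 6 + 84 * t ^ 5 + 490 * t ^ 4 - 292 * t ^ 3 - 8981 * t ^ 2 - 17640 * t - 11664 = 0) :
    t ∉ radicalSubfield := by
  intro ht
  have h3 : 3 * t ∈ radicalSubfield := mul_mem (ofNat_mem _ 3) ht
  -- Multiplying by 3^5 makes the equation monic in 3 t.
  refine notMem_solvableByRad_of_sextic_eq_zero (z := ((3 * t : ℝ) : ℂ)) ?_ h3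
  norm_cast
  linear_combination 243 * h

/-- With w the membership minus 1/2, w (v^2 + h^2) = v h. This is a quadratic equation for h over
the field generated by v and w, with discriminant (2 w h - v)^2 = v^2 - 4 w^2 v^2, so a radical
membership would make h and h^2 = t radical. -/
theorem notMem_radicalSubfield_membership {t h v : ℝ} (ht : t ∉ radicalSubfield) (hv : v ≠ 0)
    (hvS : v ∈ radicalSubfield) (hh : h ^ 2 = t) :
    (v + h) ^ 2 / (2 * (v ^ 2 + t)) ∉ radicalSubfield := by
  intro hr
  have hden : v ^ 2 + t ≠ 0 := by
    rw [← hh]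
    positivity
  have hh0 : h ≠ 0 := by
    rintro rfl
    apply ht
    rw [← hh]
    simp [zero_mem]
  set w := (v + h) ^ 2 / (2 * (v ^ 2 + t)) - 1 / 2 with hw
  have hwS : w ∈ radicalSubfield :=
    sub_mem hr (div_mem (one_mem _) (ofNat_mem _ 2))
  have hweq : w * (v ^ 2 + t) = v * h := by
    rw [hw]
    field_simp
    linear_combination hh
  have hw0 : w ≠ 0 := by
    intro h0
    rw [h0, zero_mul] at hweq
    exact mul_ne_zero hv hh0 hweq.symm
  have hsq : (2 * w * h - v) ^ 2 ∈ radicalSubfield := by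
    have : (2 * w * h - v) ^ 2 = v ^ 2 - 4 * (w ^ 2 * v ^ 2) := by
      linear_combination 4 * w * hweq + 4 * w ^ 2 * hh
    rw [this]
    exact sub_mem (pow_mem hvS 2) (mul_mem (ofNat_mem _ 4) (mul_mem (pow_mem hwS 2) (pow_mem hvS 2)))
  have hlin := mem_radicalSubfield_of_sq_mem hsq
  have hhS : h ∈ radicalSubfield := by
    have : h = ((2 * w * h - v) + v) / (2 * w) := by
      field_simp
      ring
    rw [this]
    exact div_mem (add_mem hlin hvS) (mul_mem (ofNat_mem _ 2) hwS)
  exact ht (hh ▸ pow_mem hhS 2)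

/-! ### The one-dimensional problem -/

/-- The data points `-3, -2, -1, 1, 2, 3`. -/
def lineData : Fin 6 → ℤ := ![-3, -2, -1, 1, 2, 3]

theorem lineData_injective : Function.Injective lineData := by decide

theorem lineData_ne_zero : ∀ i, lineData i ≠ 0 := by decide

theorem lineData_add_three_nonneg : ∀ i, 0 ≤ lineData i + 3 := by decide

/-- The one-dimensional cost of the means `γ` and the memberships `R`. -/
noncomputable def lineCost (γ : Fin 2 → ℝ) (R : Fin 6 → Fin 2 → ℝ) : ℝ :=
  ∑ i, ∑ k, R i k ^ 2 * (lineData i - γ k) ^ 2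

/-- Completing the square in the membership value. -/
theorem two_mul_pointCost_eq (y h r s : ℝ) (hrs : r + s = 1) :
    2 * (r ^ 2 * (y - h) ^ 2 + s ^ 2 * (y + h) ^ 2) = (y ^ 2 - h ^ 2) ^ 2 / (y ^ 2 + h ^ 2) +
      4 * (y ^ 2 + h ^ 2) * (r - (y + h) ^ 2 / (2 * (y ^ 2 + h ^ 2))) ^ 2 := by
  obtain rfl : s = 1 - r := by linarith
  by_cases h0 : y ^ 2 + h ^ 2 = 0
  · have hy : y = 0 := by nlinarith [sq_nonneg y, sq_nonneg h]
    have hh : h = 0 := by nlinarith [sq_nonneg y, sq_nonneg h]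
    subst hy hh
    simp
  · field_simp
    ring

theorem two_mul_lineCost_eq (γ : Fin 2 → ℝ) (R : Fin 6 → Fin 2 → ℝ) (hR : ∀ i, ∑ k, R i k = 1)
    {c h : ℝ} (h0 : γ 0 = c + h) (h1 : γ 1 = c - h) :
    2 * lineCost γ R =
      ∑ i, ((lineData i - c) ^ 2 - h ^ 2) ^ 2 / ((lineData i - c) ^ 2 + h ^ 2) +
      ∑ i, 4 * ((lineData i - c) ^ 2 + h ^ 2) *
        (R i 0 - (lineData i - c + h) ^ 2 / (2 * ((lineData i - c) ^ 2 + h ^ 2))) ^ 2 := by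
  rw [← Finset.sum_add_distrib, lineCost, Finset.mul_sum]
  refine Finset.sum_congr rfl fun i _ => ?_
  have hi := hR i
  rw [Fin.sum_univ_two] at hi ⊢
  rw [← two_mul_pointCost_eq (lineData i - c) h _ _ hi, h0, h1]
  ring

theorem sum_pointCost_eq_totalCost {c t : ℝ} (ht : 0 < t) :
    ∑ i, ((lineData i - c) ^ 2 - t) ^ 2 / ((lineData i - c) ^ 2 + t) = totalCost (c ^ 2) t := by
  rw [totalCost, ← pointCost_add_pointCost_neg (x := 1) ht, ← pointCost_add_pointCost_neg (x := 2) ht,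
    ← pointCost_add_pointCost_neg (x := 3) ht, Fin.sum_univ_six]
  simp [lineData]
  ring

/-- The case of coinciding means, h = 0, where `totalCost` is not used. A data point equal to c
contributes 0 / 0 = 0, which is the correct value. The total of at least 28 is far above the
minimum. -/
theorem sum_pointCost_of_eq_means (c : ℝ) :
    ∑ i, ((lineData i - c) ^ 2 - 0) ^ 2 / ((lineData i - c) ^ 2 + 0) = 28 + 6 * c ^ 2 := by
  have : ∀ z : ℝ, (z ^ 2 - 0) ^ 2 / (z ^ 2 + 0) = z ^ 2 := fun z => by
    by_cases hz : z = 0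
    · simp [hz]
    · rw [add_zero, sub_zero, pow_two (z ^ 2), mul_div_cancel_right₀ _ (pow_ne_zero 2 hz)]
  simp only [this]
  rw [Fin.sum_univ_six]
  simp [lineData]
  ring

/-- The minimizers of the one-dimensional cost. -/
theorem totalCost_critical_le_lineCost {t₀ : ℝ} (ht₀ : 0 < t₀)
    (hcrit : 3 = 4 * (1 / (1 + t₀) ^ 2 + 16 / (4 + t₀) ^ 2 + 81 / (9 + t₀) ^ 2))
    (γ : Fin 2 → ℝ) (R : Fin 6 → Fin 2 → ℝ) (hR : ∀ i, ∑ k, R i k = 1) :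
    totalCost 0 t₀ ≤ 2 * lineCost γ R ∧ (2 * lineCost γ R ≤ totalCost 0 t₀ →
      γ 1 = -γ 0 ∧ γ 0 ^ 2 = t₀ ∧
        ∀ i, R i 0 = (lineData i + γ 0) ^ 2 / (2 * ((lineData i : ℝ) ^ 2 + t₀))) := by
  obtain ⟨c, hc⟩ : ∃ c, c = (γ 0 + γ 1) / 2 := ⟨_, rfl⟩
  obtain ⟨h, hh⟩ : ∃ h, h = (γ 0 - γ 1) / 2 := ⟨_, rfl⟩
  have h0 : γ 0 = c + h := by rw [hc, hh]; ring
  have h1 : γ 1 = c - h := by rw [hc, hh]; ring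
  rw [two_mul_lineCost_eq γ R hR h0 h1]
  have hnn : ∀ i ∈ Finset.univ, 0 ≤ 4 * (((lineData i : ℝ) - c) ^ 2 + h ^ 2) *
      (R i 0 - (lineData i - c + h) ^ 2 / (2 * ((lineData i - c) ^ 2 + h ^ 2))) ^ 2 :=
    fun i _ => by positivity
  have hsum := Finset.sum_nonneg hnn
  rcases eq_or_ne h 0 with rfl | hne
  · have hlt := totalCost_critical_lt ht₀ hcrit
    have := sq_nonneg c
    have h28 := sum_pointCost_of_eq_means c
    rw [zero_pow two_ne_zero] at hsum ⊢
    rw [h28]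
    exact ⟨by linarith, fun h => by linarith⟩
  · have ht : 0 < h ^ 2 := by positivity
    rw [sum_pointCost_eq_totalCost ht]
    obtain ⟨hle, heq⟩ := totalCost_critical_le ht₀ hcrit (sq_nonneg c) ht
    refine ⟨by linarith, fun hmin => ?_⟩
    obtain ⟨hc0, hht⟩ := heq (by linarith)
    have hc0 : c = 0 := pow_eq_zero_iff two_ne_zero |>.mp hc0
    have hzero := (Finset.sum_eq_zero_iff_of_nonneg hnn).mp (by linarith)
    subst hc0
    rw [zero_add] at h0
    rw [zero_sub] at h1
    refine ⟨by rw [h0, h1], by rw [h0, hht], fun i => ?_⟩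
    have hi := hzero i (Finset.mem_univ i)
    have hpos : 4 * (((lineData i : ℝ) - 0) ^ 2 + h ^ 2) ≠ 0 := by positivity
    have := pow_eq_zero_iff two_ne_zero |>.mp ((mul_eq_zero.mp hi).resolve_left hpos)
    rw [sub_zero] at this
    rw [h0, ← hht]
    linarith

/-- Optimal memberships for the means `√t` and `-√t`. -/
noncomputable def symmetricMembership (t : ℝ) (i : Fin 6) : Fin 2 → ℝ :=
  ![(lineData i + √t) ^ 2 / (2 * ((lineData i : ℝ) ^ 2 + t)),
    (lineData i - √t) ^ 2 / (2 * ((lineData i : ℝ) ^ 2 + t))]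

theorem sum_symmetricMembership {t : ℝ} (ht : 0 < t) (i : Fin 6) :
    ∑ k, symmetricMembership t i k = 1 := by
  have : (lineData i : ℝ) ^ 2 + t ≠ 0 := by positivity
  rw [Fin.sum_univ_two]
  simp only [symmetricMembership, Matrix.cons_val_zero, Matrix.cons_val_one]
  field_simp
  linear_combination 2 * Real.sq_sqrt ht.le

theorem isMembership_symmetricMembership {t : ℝ} (ht : 0 < t) :
    IsMembership (symmetricMembership t) := by
  refine ⟨fun i k => ?_, sum_symmetricMembership ht⟩
  have hs := sum_symmetricMembership ht i
  rw [Fin.sum_univ_two] at hs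
  have h0 : 0 ≤ symmetricMembership t i 0 := by
    simp only [symmetricMembership, Matrix.cons_val_zero]
    positivity
  have h1 : 0 ≤ symmetricMembership t i 1 := by
    simp only [symmetricMembership, Matrix.cons_val_one, Matrix.cons_val_zero]
    positivity
  fin_cases k
  · exact ⟨h0, by simpa using by linarith⟩
  · exact ⟨h1, by simpa using by linarith⟩

theorem two_mul_lineCost_symmetric {t : ℝ} (ht : 0 < t) :
    2 * lineCost ![√t, -√t] (symmetricMembership t) = totalCost 0 t := by
  rw [two_mul_lineCost_eq _ _ (sum_symmetricMembership ht) (c := 0) (h := √t) (by simp) (by simp),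
    Real.sq_sqrt ht.le, sum_pointCost_eq_totalCost ht]
  simp [symmetricMembership]

/-! ### Data on the diagonal in dimension D -/

/-- For data points on the diagonal, the cost is the sum of one-dimensional costs. -/
theorem cost_eq_sum_lineCost {ι : Type*} [Fintype ι] {D : ℕ} (e : Fin 6 ≃ ι) (a : ℤ)
    (x : ι → EuclideanSpace ℝ (Fin D)) (hx : ∀ i d, x (e i) d = lineData i + a)
    (C : Fin 2 → EuclideanSpace ℝ (Fin D)) (R : ι → Fin 2 → ℝ) :
    cost 2 x (fun _ => 1) C R = ∑ d, lineCost (fun k => C k d - a) (fun i => R (e i)) := by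
  rw [cost, ← e.sum_comp]
  simp only [lineCost, EuclideanSpace.real_norm_sq_eq, PiLp.sub_apply, hx, mul_one, Finset.mul_sum]
  rw [Finset.sum_comm (s := (Finset.univ : Finset (Fin D)))]
  refine Finset.sum_congr rfl fun i _ => ?_
  rw [Finset.sum_comm]
  refine Finset.sum_congr rfl fun d _ => Finset.sum_congr rfl fun k _ => ?_
  ring

/-- Six points on the diagonal that are a translate of `-3, -2, -1, 1, 2, 3` form an instance whose
optimal solutions are not solvable by radicals. -/
theorem notOptimallySolvableByRadicals_of_diagonal {ι : Type*} [Fintype ι] {D : ℕ} (hD : 1 ≤ D)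
    (e : Fin 6 ≃ ι) (a : ℤ) (x : ι → EuclideanSpace ℝ (Fin D))
    (hx : ∀ i d, x (e i) d = lineData i + a) : NotOptimallySolvableByRadicals 2 2 x := by
  obtain ⟨t, ht, hcrit, hsextic⟩ := exists_critical_point
  have htS := notMem_radicalSubfield_of_sextic hsextic
  have hle := totalCost_critical_le_lineCost ht hcrit
  let C₀ : Fin 2 → EuclideanSpace ℝ (Fin D) :=
    fun k => WithLp.toLp 2 fun _ => (![√t, -√t] : Fin 2 → ℝ) k + a
  let R₀ : ι → Fin 2 → ℝ := fun n => symmetricMembership t (e.symm n)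
  have hR₀ : IsMembership R₀ :=
    ⟨fun n => (isMembership_symmetricMembership ht).1 (e.symm n),
      fun n => (isMembership_symmetricMembership ht).2 (e.symm n)⟩
  have hcost₀ : cost 2 x (fun _ => 1) C₀ R₀ = ∑ _d : Fin D, totalCost 0 t / 2 := by
    rw [cost_eq_sum_lineCost e a x hx]
    refine Finset.sum_congr rfl fun d _ => ?_
    rw [← two_mul_lineCost_symmetric ht]
    simp [C₀, R₀]
  refine ⟨⟨C₀, R₀, hR₀, fun C R hR => ?_⟩, fun C R ⟨hR, hopt⟩ => ?_⟩
  · rw [hcost₀, cost_eq_sum_lineCost e a x hx]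
    refine Finset.sum_le_sum fun d _ => ?_
    linarith [(hle (fun k => C k d - a) (fun i => R (e i)) fun i => hR.2 (e i)).1]
  -- Each coordinate costs at least the one-dimensional minimum, and the sum attains D times this
  -- minimum, so every coordinate is optimal by itself.
  · have hmin : ∀ d, totalCost 0 t / 2 = lineCost (fun k => C k d - a) (fun i => R (e i)) := by
      have hle' : ∀ d ∈ Finset.univ,
          totalCost 0 t / 2 ≤ lineCost (fun k => C k d - a) (fun i => R (e i)) := fun d _ => by
        linarith [(hle (fun k => C k d - a) (fun i => R (e i)) fun i => hR.2 (e i)).1]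
      have hge := hopt C₀ R₀ hR₀
      rw [hcost₀, cost_eq_sum_lineCost e a x hx] at hge
      exact fun d => (Finset.sum_eq_sum_iff_of_le hle').mp
        (le_antisymm (Finset.sum_le_sum hle') hge) d (Finset.mem_univ d)
    have hsol := fun d => (hle (fun k => C k d - a) (fun i => R (e i)) fun i => hR.2 (e i)).2
      (by linarith [hmin d])
    have haS : (a : ℝ) ∈ radicalSubfield := intCast_mem _ a
    constructor
    · intro k d hC
      obtain ⟨h1, h0, -⟩ := hsol d
      have hCk : C k d - a ∈ radicalSubfield := sub_mem (mem_radicalSubfield.mpr hC) haS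
      apply htS
      rw [← h0]
      fin_cases k
      · exact pow_mem hCk 2
      · rw [← neg_sq, ← h1]
        exact pow_mem hCk 2
    · intro n k hr
      obtain ⟨i, rfl⟩ := e.surjective n
      -- Any one coordinate determines the memberships; one exists because D ≥ 1.
      obtain ⟨-, h0, hRi⟩ := hsol ⟨0, hD⟩
      have hnot := notMem_radicalSubfield_membership htS (Int.cast_ne_zero.mpr (lineData_ne_zero i))
        (intCast_mem _ (lineData i)) h0
      apply hnot
      rw [← hRi i]
      have hsum := hR.2 (e i)
      rw [Fin.sum_univ_two] at hsum
      fin_cases k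
      · exact hr
      · rw [eq_sub_of_add_eq hsum]
        exact sub_mem (one_mem _) hr

theorem notOptimallySolvableByRadicals_points {D : ℕ} (hD : 1 ≤ D) (a : ℤ)
    (X : Finset (Fin D → ℤ)) (hX : X = Finset.univ.image fun i _ => lineData i + a) :
    NotOptimallySolvableByRadicals 2 2 (points X) := by
  let f : Fin 6 → X := fun i => ⟨fun _ => lineData i + a, by simp [hX]⟩
  have hf : Function.Bijective f := by
    constructor
    · intro i j hij
      have := congrFun (congrArg Subtype.val hij) ⟨0, hD⟩
      exact lineData_injective (add_right_cancel this)
    · rintro ⟨p, hp⟩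
      obtain ⟨i, -, hi⟩ := Finset.mem_image.mp (hX ▸ hp)
      exact ⟨i, Subtype.ext hi⟩
  refine notOptimallySolvableByRadicals_of_diagonal hD (Equiv.ofBijective f hf) a _ fun i d => ?_
  simp [points, f]

theorem theorem1 :
    FuzzyKMeans.NotOptimallySolvableByRadicals 2 2
      (FuzzyKMeans.points (D := 1) {![-3], ![-2], ![-1], ![1], ![2], ![3]}) ∧
    ∀ D : ℕ, 1 ≤ D → ∃ X : Finset (Fin D → ℤ),
      X.card = 6 ∧ (∀ p ∈ X, ∀ d, 0 ≤ p d) ∧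
      FuzzyKMeans.NotOptimallySolvableByRadicals 2 2 (FuzzyKMeans.points X) := by
  refine ⟨notOptimallySolvableByRadicals_points le_rfl 0 _ (by decide), fun D hD => ?_⟩
  -- The shift by 3 is the least that makes all coordinates nonnegative.
  refine ⟨Finset.univ.image fun i _ => lineData i + 3, ?_, ?_,
    notOptimallySolvableByRadicals_points hD 3 _ rfl⟩
  · rw [Finset.card_image_of_injective, Finset.card_univ, Fintype.card_fin]
    intro i j hij
    exact lineData_injective (add_right_cancel (congrFun hij ⟨0, hD⟩))
  · intro p hp d
    obtain ⟨i, -, rfl⟩ := Finset.mem_image.mp hp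
    exact lineData_add_three_nonneg i
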